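/- Let $\mathbb K\in\{\mathbb R,\mathbb C\}$, $0<r<1$ and $1<p<\infty$. For a scalar sequence $x=(x_k)_{k\ge 0}$ write $$(T(r)x)_n=\sum_{k=n}^{\infty}\binom{k}{n}(1-r)^{n+1}r^{k-n}x_k\qquad(n=0,1,2,\dots)$$ whenever all these series converge, and let $t_p^r$ be the space of all sequences $x$ for which $T(r)x$ exists and lies in $\ell_p$, with $\|x\|_{t_p^r}=\|T(r)x\|_{\ell_p}$, where two sequences $x,x'$ with $\|x-x'\|_{t_p^r}=0$ are identified. Then the normed space $t_p^r$ has the weak fixed point property: for every nonempty, convex, weakly compact set $C\subseteq t_p^r$ and every map $F:C\to C$ with $\|F(x)-F(y)\|\le\|x-y\|$ for all $x,y\in C$, there is an $x\in C$ with $F(x)=x$. -/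

import Mathlib

open Filter Topology
open scoped ENNReal

noncomputable section

/-- The entry `t_{nk}^r` of the Taylor matrix `T(r)` (the circle method of order `r`). -/
def taylorEntry (r : ℝ) (n k : ℕ) : ℝ :=
  if n ≤ k then (k.choose n : ℝ) * (1 - r) ^ (n + 1) * r ^ (k - n) else 0

/-- The `N`-th partial sum of the series `∑_k t_{nk}^r x_k`. -/
def taylorPartialSum {𝕜 : Type*} [RCLike 𝕜] (r : ℝ) (x : ℕ → 𝕜) (n N : ℕ) : 𝕜 :=
  ∑ k ∈ Finset.range N, ((taylorEntry r n k : ℝ) : 𝕜) * x k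

/-- Every series `∑_k t_{nk}^r x_k`, `n = 0, 1, 2, …`, converges (as a limit of partial sums). -/
def HasTaylorTransform {𝕜 : Type*} [RCLike 𝕜] (r : ℝ) (x : ℕ → 𝕜) : Prop :=
  ∀ n, ∃ l : 𝕜, Tendsto (taylorPartialSum r x n) atTop (𝓝 l)

/-- The Taylor transform `T(r)x`; it is only used for `x` with `HasTaylorTransform r x`. -/
def taylorTransform {𝕜 : Type*} [RCLike 𝕜] (r : ℝ) (x : ℕ → 𝕜) (n : ℕ) : 𝕜 :=
  limUnder atTop (taylorPartialSum r x n)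

theorem HasTaylorTransform.tendsto {𝕜 : Type*} [RCLike 𝕜] {r : ℝ} {x : ℕ → 𝕜}
    (h : HasTaylorTransform r x) (n : ℕ) :
    Tendsto (taylorPartialSum r x n) atTop (𝓝 (taylorTransform r x n)) :=
  tendsto_nhds_limUnder (h n)

theorem tendsto_taylorPartialSum_add {𝕜 : Type*} [RCLike 𝕜] {r : ℝ} {x y : ℕ → 𝕜}
    (hx : HasTaylorTransform r x) (hy : HasTaylorTransform r y) (n : ℕ) :
    Tendsto (taylorPartialSum r (x + y) n) atTop
      (𝓝 (taylorTransform r x n + taylorTransform r y n)) := by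
  have h := (hx.tendsto n).add (hy.tendsto n)
  refine h.congr fun N => ?_
  simp [taylorPartialSum, mul_add, Finset.sum_add_distrib]

theorem tendsto_taylorPartialSum_smul {𝕜 : Type*} [RCLike 𝕜] {r : ℝ} (c : 𝕜) {x : ℕ → 𝕜}
    (hx : HasTaylorTransform r x) (n : ℕ) :
    Tendsto (taylorPartialSum r (c • x) n) atTop (𝓝 (c * taylorTransform r x n)) := by
  have h := (hx.tendsto n).const_mul c
  refine h.congr fun N => ?_
  simp only [taylorPartialSum, Finset.mul_sum, Pi.smul_apply, smul_eq_mul]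
  exact Finset.sum_congr rfl fun k _ => by ring

theorem tendsto_taylorPartialSum_zero {𝕜 : Type*} [RCLike 𝕜] (r : ℝ) (n : ℕ) :
    Tendsto (taylorPartialSum r (0 : ℕ → 𝕜) n) atTop (𝓝 0) := by
  refine tendsto_const_nhds.congr fun N => ?_
  simp [taylorPartialSum]

theorem taylorTransform_add {𝕜 : Type*} [RCLike 𝕜] {r : ℝ} {x y : ℕ → 𝕜}
    (hx : HasTaylorTransform r x) (hy : HasTaylorTransform r y) :
    taylorTransform r (x + y) = taylorTransform r x + taylorTransform r y :=
  funext fun n => (tendsto_taylorPartialSum_add hx hy n).limUnder_eq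

theorem taylorTransform_smul {𝕜 : Type*} [RCLike 𝕜] {r : ℝ} (c : 𝕜) {x : ℕ → 𝕜}
    (hx : HasTaylorTransform r x) :
    taylorTransform r (c • x) = c • taylorTransform r x :=
  funext fun n => (tendsto_taylorPartialSum_smul c hx n).limUnder_eq

theorem taylorTransform_zero {𝕜 : Type*} [RCLike 𝕜] (r : ℝ) :
    taylorTransform r (0 : ℕ → 𝕜) = 0 :=
  funext fun n => (tendsto_taylorPartialSum_zero r n).limUnder_eq

/-- The set `t_p^r` of all scalar sequences whose Taylor transform exists and lies in `ℓ_p`, as a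
linear subspace of the space of all sequences. -/
def taylorSubmodule (𝕜 : Type*) [RCLike 𝕜] (r : ℝ) (p : ℝ≥0∞) : Submodule 𝕜 (ℕ → 𝕜) where
  carrier := {x | HasTaylorTransform r x ∧ Memℓp (taylorTransform r x) p}
  zero_mem' := ⟨fun n => ⟨0, tendsto_taylorPartialSum_zero r n⟩, by
    rw [taylorTransform_zero]; exact zero_memℓp⟩
  add_mem' := fun {x y} hx hy =>
    ⟨fun n => ⟨_, tendsto_taylorPartialSum_add hx.1 hy.1 n⟩, by
      rw [taylorTransform_add hx.1 hy.1]; exact hx.2.add hy.2⟩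
  smul_mem' := fun c x hx =>
    ⟨fun n => ⟨_, tendsto_taylorPartialSum_smul c hx.1 n⟩, by
      rw [taylorTransform_smul c hx.1]; exact hx.2.const_smul c⟩

/-- The sequences in `t_p^r`, as a type of its own: its topology comes from
`‖x‖ = ‖T(r)x‖_{ℓ_p}` and not from the product topology on sequences. -/
def TaylorSeq (𝕜 : Type*) [RCLike 𝕜] (r : ℝ) (p : ℝ≥0∞) : Type _ :=
  taylorSubmodule 𝕜 r p

instance (𝕜 : Type*) [RCLike 𝕜] (r : ℝ) (p : ℝ≥0∞) : AddCommGroup (TaylorSeq 𝕜 r p) :=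
  inferInstanceAs (AddCommGroup (taylorSubmodule 𝕜 r p))

instance (𝕜 : Type*) [RCLike 𝕜] (r : ℝ) (p : ℝ≥0∞) : Module 𝕜 (TaylorSeq 𝕜 r p) :=
  inferInstanceAs (Module 𝕜 (taylorSubmodule 𝕜 r p))

/-- The linear map `x ↦ T(r)x` from `t_p^r` to `ℓ_p`. -/
def TaylorSeq.toLp (𝕜 : Type*) [RCLike 𝕜] (r : ℝ) (p : ℝ≥0∞) :
    TaylorSeq 𝕜 r p →ₗ[𝕜] lp (fun _ : ℕ => 𝕜) p where
  toFun x := ⟨taylorTransform r x.1, x.2.2⟩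
  map_add' x y := Subtype.ext (taylorTransform_add x.2.1 y.2.1)
  map_smul' c x := Subtype.ext (taylorTransform_smul c x.2.1)

/-- `‖x‖ = ‖T(r)x‖_{ℓ_p}` on `t_p^r`. -/
instance (𝕜 : Type*) [RCLike 𝕜] (r : ℝ) (p : ℝ≥0∞) [Fact (1 ≤ p)] :
    SeminormedAddCommGroup (TaylorSeq 𝕜 r p) :=
  SeminormedAddCommGroup.induced _ _ (TaylorSeq.toLp 𝕜 r p)

instance (𝕜 : Type*) [RCLike 𝕜] (r : ℝ) (p : ℝ≥0∞) [Fact (1 ≤ p)] :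
    NormedSpace 𝕜 (TaylorSeq 𝕜 r p) :=
  NormedSpace.induced 𝕜 (TaylorSeq 𝕜 r p) (lp (fun _ : ℕ => 𝕜) p) (TaylorSeq.toLp 𝕜 r p)

/-- The normed space `t_p^r`: sequences `x`, `x'` with `‖x - x'‖ = ‖T(r)(x - x')‖_{ℓ_p} = 0` are
identified. (There are nonzero sequences whose Taylor transform exists and is zero: the Taylor
coefficients at `0`, each divided by `r ^ k`, of `exp (-(1 - z) ^ (-1/2))`, which is smooth on the
closed unit disc and flat at `z = 1`.) -/
abbrev TaylorSpace (𝕜 : Type*) [RCLike 𝕜] (r : ℝ) (p : ℝ≥0∞) [Fact (1 ≤ p)] : Type _ :=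
  SeparationQuotient (TaylorSeq 𝕜 r p)

/-- The weak fixed point property of a normed space: every nonexpansive self-map of a nonempty
weakly compact convex subset has a fixed point. -/
def WeakFixedPointProperty (𝕜 : Type*) [RCLike 𝕜] (X : Type*) [NormedAddCommGroup X]
    [NormedSpace 𝕜 X] : Prop :=
  ∀ C : Set X, C.Nonempty →
    (∀ x ∈ C, ∀ y ∈ C, ∀ a b : ℝ, 0 ≤ a → 0 ≤ b → a + b = 1 → (a : 𝕜) • x + (b : 𝕜) • y ∈ C) →
    IsCompact (toWeakSpace 𝕜 X '' C) →
    ∀ F : C → C, (∀ x y : C, ‖(F x : X) - (F y : X)‖ ≤ ‖(x : X) - (y : X)‖) →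
      ∃ x : C, F x = x

end

/-!
A nonexpansive self-map `F` of a weakly compact convex set `C` has approximate fixed points `u`, the
fixed points of the contractions `(1 - t) F + t x₀`; along an ultrafilter they converge weakly to
some `x ∈ C`. Since `‖u - F x‖ ≤ ‖u - F u‖ + ‖u - x‖`, the point `F x` is asymptotically at least as
close to `u` as the weak limit `x` is, and Opial's property says that only `x` itself can be.

In `ℓ_p` the property holds because `‖u - y‖ ^ p → lim ‖u - x‖ ^ p + ‖x - y‖ ^ p` whenever `u → x`
coordinatewise, and it passes to `t_p^r` because `T(r)` embeds this space isometrically in `ℓ_p`.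
-/

open Bornology

section WeakTopology

variable {𝕜 X : Type*} [RCLike 𝕜] [SeminormedAddCommGroup X] [NormedSpace 𝕜 X] {C : Set X}

theorem isCompact_toWeakDual_image_inclusionInDoubleDual
    (hC : IsCompact (toWeakSpace 𝕜 X '' C)) :
    IsCompact (StrongDual.toWeakDual '' (NormedSpace.inclusionInDoubleDualLi 𝕜 '' C)) := by
  simpa only [Set.image_image] using!
    hC.image (NormedSpace.inclusionInDoubleDualWeak 𝕜 X).continuous

theorem isBounded_of_isCompact_toWeakSpace_image
    (hC : IsCompact (toWeakSpace 𝕜 X '' C)) : IsBounded C := by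
  have hbdd := WeakDual.isBounded_iff_isVonNBounded.2
    ((isCompact_toWeakDual_image_inclusionInDoubleDual hC).isVonNBounded 𝕜)
  rw [← WeakDual.isBounded_toWeakDual_preimage_iff_isBounded,
    Set.preimage_image_eq _ StrongDual.toWeakDual.injective] at hbdd
  exact ((NormedSpace.inclusionInDoubleDualLi 𝕜).antilipschitz.isBounded_preimage hbdd).subset
    (Set.subset_preimage_image _ C)

/-- Completeness is inherited from the bidual, in which the image of `C` is weak-* closed. -/
theorem isComplete_of_isCompact_toWeakSpace_image
    (hC : IsCompact (toWeakSpace 𝕜 X '' C)) : IsComplete C := by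
  have hclosed := (isCompact_toWeakDual_image_inclusionInDoubleDual hC).isClosed.preimage
    NormedSpace.Dual.toWeakDual_continuous
  rw [Set.preimage_image_eq _ StrongDual.toWeakDual.injective] at hclosed
  exact (NormedSpace.inclusionInDoubleDualLi 𝕜).isometry.isUniformInducing.isComplete_iff.1
    hclosed.isComplete

end WeakTopology

theorem tendsto_of_tendsto_toWeakSpace {𝕜 X ι : Type*} [RCLike 𝕜] [NormedAddCommGroup X]
    [NormedSpace 𝕜 X] [FiniteDimensional 𝕜 X] {l : Filter ι} {u : ι → X} {x : X}
    (h : Tendsto (fun i => toWeakSpace 𝕜 X (u i)) l (𝓝 (toWeakSpace 𝕜 X x))) :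
    Tendsto u l (𝓝 x) := by
  have : FiniteDimensional 𝕜 (WeakSpace 𝕜 X) := ‹FiniteDimensional 𝕜 X›
  have hcont := (toWeakSpace 𝕜 X).symm.toLinearMap.continuous_of_finiteDimensional
  exact (hcont.tendsto (toWeakSpace 𝕜 X x)).comp h

theorem exists_tendsto_ultrafilter_of_isBounded_range {ι X : Type*} [PseudoMetricSpace X]
    [ProperSpace X] {f : ι → X} (hf : IsBounded (Set.range f)) (U : Ultrafilter ι) :
    ∃ a, Tendsto f U (𝓝 a) := by
  obtain ⟨a, -, ha⟩ := hf.isCompact_closure.ultrafilter_le_nhds (U.map f)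
    (le_principal_iff.2 (Filter.mem_map.2
      (Filter.univ_mem' fun i => subset_closure (Set.mem_range_self i))))
  exact ⟨a, ha⟩

section ApproximateFixedPoints

variable {X : Type*} [NormedAddCommGroup X] [NormedSpace ℝ X] {C : Set X} {F : C → C}

theorem exists_eq_lineMap_of_lipschitzWith_one (hconv : Convex ℝ C) (hcomp : IsComplete C)
    (hF : LipschitzWith 1 F) (x₀ : C) {t : ℝ} (ht₀ : 0 < t) (ht₁ : t ≤ 1) :
    ∃ x : C, (x : X) = AffineMap.lineMap (F x : X) (x₀ : X) t := by
  have := hcomp.completeSpace_coe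
  have : Nonempty C := ⟨x₀⟩
  let G : C → C := fun x =>
    ⟨AffineMap.lineMap (F x : X) (x₀ : X) t, hconv.lineMap_mem (F x).2 x₀.2 ⟨ht₀.le, ht₁⟩⟩
  have hG : ContractingWith (1 - t).toNNReal G := by
    refine ⟨by simpa using ht₀, LipschitzWith.of_dist_le_mul fun x y => ?_⟩
    have hdist : dist (G x) (G y) = (1 - t) * dist (F x) (F y) := by
      simp only [G, Subtype.dist_eq, AffineMap.lineMap_apply_module, dist_add_right, dist_smul₀,
        Real.norm_of_nonneg (sub_nonneg.2 ht₁)]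
    rw [hdist, Real.coe_toNNReal _ (sub_nonneg.2 ht₁)]
    have := sub_nonneg.2 ht₁
    gcongr
    simpa using hF.dist_le_mul x y
  exact ⟨hG.fixedPoint G, congrArg Subtype.val hG.fixedPoint_isFixedPt.symm⟩

theorem exists_seq_tendsto_dist_of_lipschitzWith_one (hne : C.Nonempty) (hconv : Convex ℝ C)
    (hcomp : IsComplete C) (hbdd : IsBounded C) (hF : LipschitzWith 1 F) :
    ∃ u : ℕ → C, Tendsto (fun n => dist (u n) (F (u n))) atTop (𝓝 0) := by
  obtain ⟨x₀, hx₀⟩ := hne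
  choose u hu using fun n : ℕ => exists_eq_lineMap_of_lipschitzWith_one hconv hcomp hF ⟨x₀, hx₀⟩
    (Nat.one_div_pos_of_nat (α := ℝ) (n := n))
    (by simpa using Nat.one_div_le_one_div (α := ℝ) n.zero_le)
  have hlim : Tendsto (fun n : ℕ => 1 / ((n : ℝ) + 1) * Metric.diam C) atTop (𝓝 0) := by
    simpa only [zero_mul] using
      tendsto_one_div_add_atTop_nhds_zero_nat.mul_const (Metric.diam C)
  refine ⟨u, squeeze_zero (fun _ => dist_nonneg) (fun n => ?_) hlim⟩
  calc dist (u n) (F (u n)) = 1 / ((n : ℝ) + 1) * dist (F (u n) : X) x₀ := by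
        rw [Subtype.dist_eq, hu n, dist_lineMap_left, Real.norm_of_nonneg (by positivity)]
    _ ≤ 1 / ((n : ℝ) + 1) * Metric.diam C := by
        gcongr
        exact Metric.dist_le_diam_of_mem hbdd (F (u n)).2 hx₀

end ApproximateFixedPoints

/-- Opial's property of a normed space: the asymptotic distance to a weakly convergent family is
strictly smaller at its weak limit than at any other point. It is stated for filters on `X` along
which the two distances converge, so that it applies to weak limits along ultrafilters. -/
def OpialProperty (𝕜 : Type*) [RCLike 𝕜] (X : Type*) [NormedAddCommGroup X]
    [NormedSpace 𝕜 X] : Prop :=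
  ∀ ⦃l : Filter X⦄ [l.NeBot] ⦃x y : X⦄ ⦃a b : ℝ⦄,
    Tendsto (toWeakSpace 𝕜 X) l (𝓝 (toWeakSpace 𝕜 X x)) →
    Tendsto (fun v => ‖v - x‖) l (𝓝 a) → Tendsto (fun v => ‖v - y‖) l (𝓝 b) → x ≠ y → a < b

namespace OpialProperty

variable {𝕜 X Y : Type*} [RCLike 𝕜] [NormedAddCommGroup X] [NormedSpace 𝕜 X]
  [NormedAddCommGroup Y] [NormedSpace 𝕜 Y]

theorem of_linearIsometry (hY : OpialProperty 𝕜 Y) (j : X →ₗᵢ[𝕜] Y) : OpialProperty 𝕜 X := by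
  intro l _ x y a b hweak ha hb hxy
  refine hY (l := l.map j) (x := j x) (y := j y) (tendsto_map'_iff.2 ?_) (tendsto_map'_iff.2 ?_)
    (tendsto_map'_iff.2 ?_) (j.injective.ne hxy)
  · exact ((WeakSpace.map j.toContinuousLinearMap).continuous.tendsto _).comp hweak
  · simpa only [Function.comp_def, ← map_sub, j.norm_map] using ha
  · simpa only [Function.comp_def, ← map_sub, j.norm_map] using hb

theorem isFixedPt_of_tendsto (hX : OpialProperty 𝕜 X) {C : Set X} (hbdd : IsBounded C) {F : C → C}
    (hF : LipschitzWith 1 F) {ι : Type*} {U : Ultrafilter ι} {u : ι → C} {x : C}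
    (hu : Tendsto (fun i => dist (u i) (F (u i))) U (𝓝 0))
    (hx : Tendsto (fun i => toWeakSpace 𝕜 X (u i)) U (𝓝 (toWeakSpace 𝕜 X x))) :
    Function.IsFixedPt F x := by
  have exists_tendsto_dist (y : C) : ∃ a, Tendsto (fun i => dist (u i) y) U (𝓝 a) := by
    refine exists_tendsto_ultrafilter_of_isBounded_range
      ((Metric.isBounded_Icc 0 (Metric.diam C)).subset ?_) U
    rintro _ ⟨i, rfl⟩
    exact ⟨dist_nonneg, Metric.dist_le_diam_of_mem hbdd (u i).2 y.2⟩
  obtain ⟨a, ha⟩ := exists_tendsto_dist x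
  obtain ⟨b, hb⟩ := exists_tendsto_dist (F x)
  have hba : b ≤ a := by
    refine le_of_tendsto_of_tendsto' hb (by simpa using hu.add ha) fun i => ?_
    calc dist (u i) (F x) ≤ dist (u i) (F (u i)) + dist (F (u i)) (F x) := dist_triangle _ _ _
      _ ≤ dist (u i) (F (u i)) + dist (u i) x := by
        gcongr
        simpa using hF.dist_le_mul (u i) x
  by_contra hne
  simp only [Subtype.dist_eq, dist_eq_norm] at ha hb
  have hab : a < b := hX (l := (U : Filter ι).map fun i => (u i : X)) (tendsto_map'_iff.2 hx)
    (tendsto_map'_iff.2 ha) (tendsto_map'_iff.2 hb) (Subtype.coe_injective.ne (Ne.symm hne))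
  exact hab.not_ge hba

theorem weakFixedPointProperty (hX : OpialProperty 𝕜 X) : WeakFixedPointProperty 𝕜 X := by
  intro C hne hconv hC F hF
  let _ : NormedSpace ℝ X := NormedSpace.restrictScalars ℝ 𝕜 X
  have hconvR : Convex ℝ C := convex_iff_forall_pos.2 fun x hx y hy a b ha hb hab =>
    hconv x hx y hy a b ha.le hb.le hab
  have hbdd := isBounded_of_isCompact_toWeakSpace_image hC
  have hF₁ : LipschitzWith 1 F := LipschitzWith.mk_one fun x y => by
    simpa only [Subtype.dist_eq, dist_eq_norm] using hF x y
  obtain ⟨u, hu⟩ := exists_seq_tendsto_dist_of_lipschitzWith_one hne hconvR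
    (isComplete_of_isCompact_toWeakSpace_image hC) hbdd hF₁
  obtain ⟨_, ⟨x, hx, rfl⟩, hlim⟩ := hC.ultrafilter_le_nhds
    ((hyperfilter ℕ).map fun n => toWeakSpace 𝕜 X (u n))
    (le_principal_iff.2 (Filter.mem_map.2
      (Filter.univ_mem' fun n => Set.mem_image_of_mem _ (u n).2)))
  exact ⟨⟨x, hx⟩, hX.isFixedPt_of_tendsto hbdd hF₁ (hu.mono_left Nat.hyperfilter_le_atTop) hlim⟩

end OpialProperty

section SequenceSpaces

variable {α ι : Type*} {E : α → Type*} [∀ k, NormedAddCommGroup (E k)] {p : ℝ≥0∞}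

theorem lp_norm_sub_sum_single_rpow [DecidableEq α] (hp : 0 < p.toReal) (f : lp E p)
    (g : ∀ k, E k) (s : Finset α) :
    ‖f - ∑ k ∈ s, lp.single p k (g k)‖ ^ p.toReal =
      ‖f‖ ^ p.toReal + ∑ k ∈ s, (‖f k - g k‖ ^ p.toReal - ‖f k‖ ^ p.toReal) := by
  set h : lp E p := f - ∑ k ∈ s, lp.single p k (g k) with h_def
  have h_apply : ∀ k ∈ s, h k = f k - g k := fun k hk => by
    simp only [h_def, lp.coeFn_sub, lp.coeFn_sum, lp.coeFn_single, Pi.sub_apply, Finset.sum_apply,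
      Finset.sum_pi_single, if_pos hk]
  have h_tail : h - ∑ k ∈ s, lp.single p k (h k) = f - ∑ k ∈ s, lp.single p k (f k) := by
    rw [Finset.sum_congr rfl fun k hk => by rw [h_apply k hk, lp.single_sub],
      Finset.sum_sub_distrib, h_def]
    abel
  have h_norm : ∑ k ∈ s, ‖h k‖ ^ p.toReal = ∑ k ∈ s, ‖f k - g k‖ ^ p.toReal :=
    Finset.sum_congr rfl fun k hk => by rw [h_apply k hk]
  have hf := lp.norm_compl_sum_single hp f s
  rw [← h_tail, lp.norm_compl_sum_single hp h s, h_norm] at hf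
  rw [Finset.sum_sub_distrib]
  linarith

variable [Fact (1 ≤ p)] {l : Filter ι} {f : ι → lp E p} {a : ℝ}

theorem tendsto_lp_norm_sub_sum_single [DecidableEq α] (hp : p ≠ ∞)
    (hf : ∀ k, Tendsto (fun i => f i k) l (𝓝 0)) (ha : Tendsto (fun i => ‖f i‖) l (𝓝 a))
    (g : ∀ k, E k) (s : Finset α) :
    Tendsto (fun i => ‖f i - ∑ k ∈ s, lp.single p k (g k)‖) l
      (𝓝 ((a ^ p.toReal + ‖∑ k ∈ s, lp.single p k (g k)‖ ^ p.toReal) ^ p.toReal⁻¹)) := by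
  have hp₀ : 0 < p.toReal := ENNReal.toReal_pos (zero_lt_one.trans_le Fact.out).ne' hp
  have hterm (k : α) : Tendsto (fun i => ‖f i k - g k‖ ^ p.toReal - ‖f i k‖ ^ p.toReal) l
      (𝓝 (‖g k‖ ^ p.toReal)) := by
    simpa [Real.zero_rpow hp₀.ne'] using
      (((hf k).sub_const (g k)).norm.rpow_const (Or.inr hp₀.le)).sub
        ((hf k).norm.rpow_const (Or.inr hp₀.le))
  have hpow := (ha.rpow_const (Or.inr hp₀.le)).add (tendsto_finsetSum s fun k _ => hterm k)
  simp only [← lp_norm_sub_sum_single_rpow hp₀, ← lp.norm_sum_single hp₀] at hpow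
  simpa only [Real.rpow_rpow_inv (norm_nonneg _) hp₀.ne'] using
    hpow.rpow_const (Or.inr (inv_nonneg.2 hp₀.le))

theorem tendsto_lp_norm_sub (hp : p ≠ ∞) (hf : ∀ k, Tendsto (fun i => f i k) l (𝓝 0))
    (ha : Tendsto (fun i => ‖f i‖) l (𝓝 a)) (g : lp E p) :
    Tendsto (fun i => ‖f i - g‖) l (𝓝 ((a ^ p.toReal + ‖g‖ ^ p.toReal) ^ p.toReal⁻¹)) := by
  classical
  have hequi : Equicontinuous fun i (g : lp E p) => ‖f i - g‖ :=
    (LipschitzWith.uniformEquicontinuous _ 1 fun i => LipschitzWith.mk_one fun g g' => by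
      simpa only [dist_eq_norm, sub_sub_sub_cancel_left, norm_sub_rev g' g] using
        dist_norm_norm_le (f i - g) (f i - g')).equicontinuous
  have hcont : Continuous fun g : lp E p => (a ^ p.toReal + ‖g‖ ^ p.toReal) ^ p.toReal⁻¹ := by
    refine (continuous_const.add (continuous_norm.rpow_const fun _ => Or.inr ?_)).rpow_const
      fun _ => Or.inr ?_ <;> positivity
  exact (hequi.isClosed_setOfPred_tendsto hcont).mem_of_tendsto (lp.hasSum_single hp g)
    (Eventually.of_forall fun s => tendsto_lp_norm_sub_sum_single hp hf ha (fun k => g k) s)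

theorem opialProperty_lp (𝕜 : Type*) [RCLike 𝕜] [∀ k, NormedSpace 𝕜 (E k)]
    [∀ k, FiniteDimensional 𝕜 (E k)] (hp : p ≠ ∞) : OpialProperty 𝕜 (lp E p) := by
  intro l _ x y a b hweak ha hb hxy
  have hcoord (k : α) : Tendsto (fun v : lp E p => (v - x) k) l (𝓝 0) := by
    have hk : Tendsto (fun v : lp E p => v k) l (𝓝 (x k)) := tendsto_of_tendsto_toWeakSpace
      (((WeakSpace.map (lp.evalCLM 𝕜 E p k)).continuous.tendsto _).comp hweak)
    simpa using hk.sub_const (x k)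
  have hp₀ : 0 < p.toReal := ENNReal.toReal_pos (zero_lt_one.trans_le Fact.out).ne' hp
  have ha₀ : 0 ≤ a := ge_of_tendsto' ha fun v => norm_nonneg _
  have hb_eq : b = (a ^ p.toReal + ‖y - x‖ ^ p.toReal) ^ p.toReal⁻¹ := by
    refine tendsto_nhds_unique hb ?_
    simpa only [sub_sub_sub_cancel_right] using tendsto_lp_norm_sub hp hcoord ha (y - x)
  have hpos : 0 < ‖y - x‖ ^ p.toReal :=
    Real.rpow_pos_of_pos (norm_pos_iff.2 (sub_ne_zero.2 hxy.symm)) _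
  calc a = (a ^ p.toReal) ^ p.toReal⁻¹ := (Real.rpow_rpow_inv ha₀ hp₀.ne').symm
    _ < (a ^ p.toReal + ‖y - x‖ ^ p.toReal) ^ p.toReal⁻¹ :=
      Real.rpow_lt_rpow (by positivity) (lt_add_of_pos_right _ hpos) (inv_pos.2 hp₀)
    _ = b := hb_eq.symm

end SequenceSpaces

/-- `x ↦ T(r)x` as a linear isometry from the sequences in `t_p^r` to `ℓ_p`, for passing to the
quotient `TaylorSpace`. -/
noncomputable def TaylorSeq.toLpₗᵢ (𝕜 : Type*) [RCLike 𝕜] (r : ℝ) (p : ℝ≥0∞) [Fact (1 ≤ p)] :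
    TaylorSeq 𝕜 r p →ₗᵢ[𝕜] lp (fun _ : ℕ => 𝕜) p where
  toLinearMap := TaylorSeq.toLp 𝕜 r p
  norm_map' _ := rfl

/-- `x ↦ T(r)x` as a linear isometry from the normed space `t_p^r` to `ℓ_p`, through which `t_p^r`
inherits Opial's property. -/
noncomputable def TaylorSpace.toLpₗᵢ (𝕜 : Type*) [RCLike 𝕜] (r : ℝ) (p : ℝ≥0∞) [Fact (1 ≤ p)] :
    TaylorSpace 𝕜 r p →ₗᵢ[𝕜] lp (fun _ : ℕ => 𝕜) p where
  toLinearMap := (SeparationQuotient.liftCLM (TaylorSeq.toLpₗᵢ 𝕜 r p).toContinuousLinearMap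
    fun _ _ h => (h.map (TaylorSeq.toLpₗᵢ 𝕜 r p).continuous).eq).toLinearMap
  norm_map' := SeparationQuotient.surjective_mk.forall.2 fun _ => rfl

theorem mainTheorem9_general (𝕜 : Type*) [RCLike 𝕜] (r : ℝ) (p : ℝ≥0∞) [Fact (1 ≤ p)]
    (hp : p < ∞) : WeakFixedPointProperty 𝕜 (TaylorSpace 𝕜 r p) :=
  ((opialProperty_lp 𝕜 hp.ne).of_linearIsometry (TaylorSpace.toLpₗᵢ 𝕜 r p)).weakFixedPointProperty

theorem mainTheorem9 (𝕜 : Type*) [RCLike 𝕜] (r : ℝ) (hr0 : 0 < r) (hr1 : r < 1)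
    (p : ℝ≥0∞) [Fact (1 ≤ p)] (hp1 : 1 < p) (hp : p < ∞) :
    WeakFixedPointProperty 𝕜 (TaylorSpace 𝕜 r p) :=
  mainTheorem9_general 𝕜 r p hp
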